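/- Let $\mathbb{N}=\{0,1,2,\dots\}$. An infinite rooted ballot path is a sequence $(x_n)_{n\ge 0}$ of points of $\mathbb{N}\times\mathbb{N}$ with $x_0=(0,0)$ and $x_{n+1}-x_n\in\{(1,1),(1,-1)\}$ for all $n$. Let $\Omega$ be the set of these paths, with the $\sigma$-algebra induced by the product $\sigma$-algebra. A random ballot path is given by its law, a probability measure $\nu$ on $\Omega$. It is central if for every $(n,k)\in\mathbb{N}\times\mathbb{N}$ and every ballot path $(0,0)=v_0,v_1,\dots,v_n=(n,k)$, $$\nu(\{x\in\Omega : x_i=v_i \text{ for } 0\le i\le n\})=\frac{\nu(\{x\in\Omega : x_n=(n,k)\})}{d(n,k)},$$ where $d(n,k)$ is the number of ballot paths from $(0,0)$ to $(n,k)$. For $\lambda\in[1/2,1]$ let $\nu_\lambda$ be the law on $\Omega$ of the Markov chain $M^\lambda$ that starts at $(0,0)$ and moves from $(m,s)$ to $(m+1,s+1)$ with probability $p_\lambda(s)$ and to $(m+1,s-1)$ with probability $1-p_\lambda(s)$, where $$p_\lambda(s)=\frac{(1-\lambda)^{s+2}-\lambda^{s+2}}{(1-\lambda)^{s+1}-\lambda^{s+1}}\quad\text{for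 } \lambda\in(1/2,1],\qquad p_{1/2}(s)=\frac12\cdot\frac{s+2}{s+1}$$ (so $p_\lambda(0)=1$ and the chain never leaves $\mathbb{N}\times\mathbb{N}$). **Theorem.** Let $\nu$ be the law of a central random ballot path. Then $\nu$ is a mixture of the laws $\nu_\lambda$: there is a Borel probability measure $\mu$ on $[1/2,1]$ such that $$\nu=\int_{1/2}^1\nu_\lambda\,d\mu(\lambda),$$ that is, for every measurable $A\subseteq\Omega$ the function $\lambda\mapsto\nu_\lambda(A)$ is Borel measurable on $[1/2,1]$ and $\nu(A)=\int_{[1/2,1]}\nu_\lambda(A)\,d\mu(\lambda)$. -/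

import Mathlib

open MeasureTheory ProbabilityTheory

namespace Ballot

/-- `q` is reached from the lattice point `p` by an up-step `(1,1)` or a down-step `(1,-1)`.
Both points lie in the quadrant `ℕ × ℕ`, so no down-step leaves a point on the x-axis. -/
def IsStep (p q : ℕ × ℕ) : Prop :=
  q.1 = p.1 + 1 ∧ (q.2 = p.2 + 1 ∨ q.2 + 1 = p.2)

/-- The set of infinite ballot paths starting at the root `(0,0)`. -/
def infinitePaths : Set (ℕ → ℕ × ℕ) :=
  {ω | ω 0 = (0, 0) ∧ ∀ n, IsStep (ω n) (ω (n + 1))}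

/-- The space of infinite rooted ballot paths. As a subtype of `ℕ → ℕ × ℕ` it carries the
restriction of the product σ-algebra. -/
abbrev InfinitePath : Type := ↥infinitePaths

/-- The set of ballot paths from `(0,0)` to `(n,k)`. Each step raises the first coordinate
by one, so such a path has exactly `n` steps. -/
def pathsTo (n k : ℕ) : Set (Fin (n + 1) → ℕ × ℕ) :=
  {v | v 0 = (0, 0) ∧ v (Fin.last n) = (n, k) ∧ ∀ i : Fin n, IsStep (v i.castSucc) (v i.succ)}

/-- Centrality: every ballot path from `(0,0)` to `(n,k)` is followed with the same
probability, namely the probability of passing through `(n,k)` divided by the number of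
these paths. -/
def IsCentral (ν : Measure InfinitePath) : Prop :=
  ∀ n k : ℕ, ∀ v ∈ pathsTo n k,
    ν {ω | ∀ i : Fin (n + 1), ω.1 i = v i} =
      ν {ω | ω.1 n = (n, k)} / ((pathsTo n k).ncard : ENNReal)

/-- The probability of the up-step from height `s` for the chain with parameter `lam`. -/
noncomputable def upProb (lam : ℝ) (s : ℕ) : ℝ :=
  if lam = 1 / 2 then (1 / 2) * (((s : ℝ) + 2) / ((s : ℝ) + 1))
  else ((1 - lam) ^ (s + 2) - lam ^ (s + 2)) / ((1 - lam) ^ (s + 1) - lam ^ (s + 1))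

theorem upProb_mem {lam : ℝ} (h : lam ∈ Set.Icc (1 / 2 : ℝ) 1) (s : ℕ) :
    0 ≤ upProb lam s ∧ upProb lam s ≤ 1 := by
  obtain ⟨h1, h2⟩ := h
  unfold upProb
  split_ifs with hl
  · have hs : (0 : ℝ) ≤ s := Nat.cast_nonneg s
    refine ⟨by positivity, ?_⟩
    rw [← mul_div_assoc, div_le_one (by positivity)]
    linarith
  · have ha : 0 ≤ 1 - lam := by linarith
    have hlt : 1 - lam < lam := by
      rcases lt_or_eq_of_le h1 with h | h
      · linarith
      · exact absurd h.symm hl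
    have hp1 : (1 - lam) ^ (s + 1) < lam ^ (s + 1) := pow_lt_pow_left₀ hlt ha (by omega)
    have hp2 : (1 - lam) ^ (s + 2) < lam ^ (s + 2) := pow_lt_pow_left₀ hlt ha (by omega)
    have hp0 : (1 - lam) ^ s ≤ lam ^ s := pow_le_pow_left₀ ha hlt.le s
    constructor
    · exact div_nonneg_of_nonpos (by linarith) (by linarith)
    · rw [div_le_one_of_neg (by linarith)]
      have : 0 ≤ lam * (1 - lam) * (lam ^ s - (1 - lam) ^ s) :=
        mul_nonneg (mul_nonneg (by linarith) ha) (by linarith)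
      have e : lam * (1 - lam) * (lam ^ s - (1 - lam) ^ s) =
          ((1 - lam) ^ (s + 2) - lam ^ (s + 2)) -
            ((1 - lam) ^ (s + 1) - lam ^ (s + 1)) := by ring
      linarith

/-- One-step transition kernel of the chain: from `(m,s)` to `(m+1,s+1)` with probability
`upProb lam s` and to `(m+1,s-1)` with probability `1 - upProb lam s`. For `s = 0` the latter
probability is zero, so the truncated subtraction plays no role. -/
noncomputable def stepKernel (lam : Set.Icc (1 / 2 : ℝ) 1) : Kernel (ℕ × ℕ) (ℕ × ℕ) :=
  Kernel.ofFunOfCountable fun p =>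
    ENNReal.ofReal (upProb lam p.2) • Measure.dirac (p.1 + 1, p.2 + 1) +
      ENNReal.ofReal (1 - upProb lam p.2) • Measure.dirac (p.1 + 1, p.2 - 1)

instance isMarkovKernel_stepKernel (lam : Set.Icc (1 / 2 : ℝ) 1) :
    IsMarkovKernel (stepKernel lam) := by
  refine ⟨fun p => ⟨?_⟩⟩
  obtain ⟨h0, h1⟩ := upProb_mem lam.2 p.2
  change (ENNReal.ofReal (upProb lam p.2) • Measure.dirac (p.1 + 1, p.2 + 1) +
      ENNReal.ofReal (1 - upProb lam p.2) • Measure.dirac (p.1 + 1, p.2 - 1)) Set.univ = 1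
  simp only [Measure.add_apply, Measure.smul_apply, measure_univ, smul_eq_mul, mul_one]
  rw [← ENNReal.ofReal_add h0 (by linarith)]
  simp

/-- The same kernel, viewed as depending on the whole history up to time `n` through the
current position. -/
noncomputable def historyKernel (lam : Set.Icc (1 / 2 : ℝ) 1) (n : ℕ) :
    Kernel (Finset.Iic n → ℕ × ℕ) (ℕ × ℕ) :=
  (stepKernel lam).comap (fun x => x ⟨n, Finset.mem_Iic.2 le_rfl⟩) (measurable_pi_apply _)

instance isMarkovKernel_historyKernel (lam : Set.Icc (1 / 2 : ℝ) 1) (n : ℕ) :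
    IsMarkovKernel (historyKernel lam n) := by
  unfold historyKernel
  infer_instance

/-- The law of the Markov chain with parameter `lam` started at `(0,0)`: the trajectory measure
of the transition kernel on `ℕ → ℕ × ℕ`, restricted to the space of infinite rooted ballot paths
(which has full measure). -/
noncomputable def chainLaw (lam : Set.Icc (1 / 2 : ℝ) 1) : Measure InfinitePath :=
  (Kernel.trajMeasure (X := fun _ => ℕ × ℕ) (Measure.dirac (0, 0))
    (historyKernel lam)).comap Subtype.val

end Ballot

/-! For a central `ν`, the probability `ψ b k` of following a given path to `(2 * b + k, k)` depends
only on the endpoint, and splitting on the next step makes `ψ` harmonic. Solving the harmonic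
relation for the highest vertex shows that the floor values `ψ m 0` determine `ψ`.

The floor values are limits of moments. Conservation of mass after the floor vertex at time `2 * m`
(`floor_eq_sum`) writes `ψ m 0` as an average, over the vertices at time `M`, of the ratio between
path counts from that floor vertex and from the root. For `B` down-steps this ratio is `((B / M) *
(1 - B / M)) ^ m` up to `O(1 / M)`, uniformly in `B` (`uniformlyClose_prod_shiftRatio`). By
compactness, the laws of the fraction of up-steps have a limit point `μ`, and `ψ m 0` is the
`μ`-mean of `(lam * (1 - lam)) ^ m`.

`pathWeight lam` is harmonic with exactly these floor values, so its `μ`-mean is `ψ`. It is also the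
mass that the chain gives to a path (`sequenceLaw_cylinder`). Hence `ν` and the mixture agree on
cylinders, a generating π-system. -/

namespace Ballot

/-! ### Harmonic functions on the ballot graph. -/

/-- Harmonicity on the ballot graph. The vertex reached after `b` down-steps
at height `k` has coordinates `(2 * b + k, k)`. -/
structure IsHarmonic (ψ : ℕ → ℕ → ℝ) : Prop where
  floor : ∀ b, ψ b 0 = ψ b 1
  succ : ∀ b k, ψ b (k + 1) = ψ b (k + 2) + ψ (b + 1) k

namespace IsHarmonic

theorem shift {ψ : ℕ → ℕ → ℝ} (h : IsHarmonic ψ) (m : ℕ) :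
    IsHarmonic fun b k => ψ (b + m) k :=
  ⟨fun b => h.floor _, fun b k => by
    have := h.succ (b + m) k
    rwa [show b + m + 1 = b + 1 + m by ring] at this⟩

/-- A harmonic function is determined by its values on the floor. -/
theorem eq_of_floor {ψ φ : ℕ → ℕ → ℝ} (hψ : IsHarmonic ψ) (hφ : IsHarmonic φ)
    (h : ∀ b, ψ b 0 = φ b 0) (k b : ℕ) : ψ b k = φ b k := by
  -- Row `k + 2` is computed from rows `k + 1` and `k`; `b` varies because row `k` enters at `b +
  -- 1`.
  induction k using Nat.twoStepInduction generalizing b with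
  | zero => exact h b
  | one => rw [← hψ.floor, ← hφ.floor, h]
  | more k ih0 ih1 =>
    have h1 := hψ.succ b k
    have h2 := hφ.succ b k
    rw [ih1, ih0] at h1
    linarith

end IsHarmonic

/-! ### Ballot numbers and their ratios. -/

/-- The number of ballot paths with `N` steps of which `b` are down-steps, given by the
reflection principle. It is the right number for `2 * b ≤ N + 1`. -/
def ballotNumber (N : ℕ) : ℕ → ℝ
  | 0 => 1
  | b + 1 => (N.choose (b + 1) : ℝ) - N.choose b

theorem ballotNumber_zero (N : ℕ) : ballotNumber N 0 = 1 := rfl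

theorem ballotNumber_succ (N b : ℕ) :
    ballotNumber N (b + 1) = (N.choose (b + 1) : ℝ) - N.choose b := rfl

theorem ballotNumber_succ_succ (N b : ℕ) :
    ballotNumber (N + 1) (b + 1) = ballotNumber N (b + 1) + ballotNumber N b := by
  cases b with
  | zero => simp [ballotNumber]
  | succ b =>
    simp only [ballotNumber, Nat.choose_succ_succ']
    push_cast
    ring

/-- The endpoint has height `-1`, on the reflecting line. -/
theorem ballotNumber_eq_zero {N b : ℕ} (h : 2 * b = N + 1) : ballotNumber N b = 0 := by
  cases b with
  | zero => omega
  | succ b =>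
    obtain rfl : N = 2 * b + 1 := by omega
    rw [ballotNumber_succ, Nat.choose_symm_half, sub_self]

theorem ballotNumber_nonneg {N b : ℕ} (h : 2 * b ≤ N) : 0 ≤ ballotNumber N b := by
  cases b with
  | zero => simp [ballotNumber]
  | succ b =>
    rw [ballotNumber_succ, sub_nonneg, Nat.cast_le]
    exact Nat.choose_le_succ_of_lt_half_left (by omega)

theorem add_one_mul_ballotNumber (N b : ℕ) :
    ((N : ℝ) + 1) * ballotNumber N b = ((N : ℝ) + 1 - 2 * b) * (N + 1).choose b := by
  cases b with
  | zero => simp [ballotNumber]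
  | succ b =>
    rw [ballotNumber_succ]
    have h1 := Nat.add_one_mul_choose_eq N b
    have h2 : (N + 1).choose (b + 1) = N.choose b + N.choose (b + 1) := Nat.choose_succ_succ' N b
    have h1' : ((N : ℝ) + 1) * N.choose b = (N + 1).choose (b + 1) * (b + 1) := by exact_mod_cast h1
    have h2' : ((N + 1).choose (b + 1) : ℝ) = N.choose b + N.choose (b + 1) := by exact_mod_cast h2
    have h3 : (N.choose (b + 1) : ℝ) = (N + 1).choose (b + 1) - N.choose b := by linarith
    rw [h3]
    push_cast
    linear_combination (-2) * h1'

/-- The factor by which the number of ballot paths to a vertex shrinks when the start of the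
paths is moved along the floor from step `2 * i` to step `2 * (i + 1)`. -/
noncomputable def shiftRatio (i M B : ℕ) : ℝ :=
  -- Each factor is written as `(x + c) / (M + d)` to match `uniformlyClose_div`.
  (((B : ℝ) + -i) / (M + -(2 * i))) * (((M : ℝ) - B + (1 - i)) / (M + -(2 * i + 1)))

/-- Both counts end at height `N - 2 * b`, so in the closed form they share the factor `N + 1 - 2 *
b`; what is left is a ratio of binomials. -/
theorem ballotNumber_eq_mul_shiftRatio (N b : ℕ) :
    ballotNumber N b = ballotNumber (N + 2) (b + 1) * shiftRatio 0 (N + 2) (b + 1) := by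
  have h1 := add_one_mul_ballotNumber N b
  have h2 := add_one_mul_ballotNumber (N + 2) (b + 1)
  have h3 : ((N + 3 : ℕ) : ℝ) * (N + 2).choose b = (N + 3).choose (b + 1) * ((b + 1 : ℕ) : ℝ) := by
    exact_mod_cast Nat.add_one_mul_choose_eq (N + 2) b
  have h4 : ((N + 2).choose b : ℝ) * ((N + 2 : ℝ) - b) = (N + 2) * (N + 1).choose b := by
    rcases le_or_gt b (N + 2) with h | h
    · have := Nat.choose_mul_succ_eq (N + 1) b
      have h5 : ((N + 1).choose b : ℝ) * ((N + 1 + 1 : ℕ) : ℝ) =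
          (N + 1 + 1).choose b * ((N + 1 + 1 - b : ℕ) : ℝ) := by exact_mod_cast this
      rw [Nat.cast_sub h] at h5
      push_cast at h5
      linear_combination -h5
    · rw [Nat.choose_eq_zero_of_lt h, Nat.choose_eq_zero_of_lt (by omega)]
      simp
  have hN : (0 : ℝ) ≤ N := Nat.cast_nonneg N
  have e : shiftRatio 0 (N + 2) (b + 1) =
      ((b + 1 : ℝ) * (N + 2 - b)) / ((N + 2) * (N + 1)) := by
    unfold shiftRatio
    push_cast
    rw [div_mul_div_comm]
    congr 1 <;> ring
  rw [e, mul_div_assoc', eq_div_iff (by positivity)]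
  push_cast at h1 h2 h3
  have hN3 : (N : ℝ) + 3 ≠ 0 := by positivity
  apply mul_left_cancel₀ hN3
  linear_combination ((N : ℝ) + 3) * (N + 2) * h1 - (b + 1 : ℝ) * (N + 2 - b) * h2 +
    (N + 1 - 2 * b : ℝ) * (N + 2 - b) * h3 - (N + 3 : ℝ) * (N + 1 - 2 * b) * h4

theorem shiftRatio_succ (i M B : ℕ) :
    shiftRatio (i + 1) (M + 2) (B + 1) = shiftRatio i M B := by
  unfold shiftRatio
  push_cast
  congr 2 <;> ring

theorem ballotNumber_eq_mul_prod (m N b : ℕ) :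
    ballotNumber N b = ballotNumber (N + 2 * m) (b + m) *
      ∏ i ∈ Finset.range m, shiftRatio i (N + 2 * m) (b + m) := by
  induction m with
  | zero => simp
  | succ m ih =>
    rw [ih, Finset.prod_range_succ', ballotNumber_eq_mul_shiftRatio (N + 2 * m) (b + m)]
    simp only [show N + 2 * (m + 1) = N + 2 * m + 2 by ring, ← add_assoc, shiftRatio_succ]
    ring

/-! ### Conservation of mass. -/

/-- The values of `ψ` at time `N`, indexed by the number of down-steps. -/
def level (ψ : ℕ → ℕ → ℝ) (N b : ℕ) : ℝ := if 2 * b ≤ N then ψ b (N - 2 * b) else 0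

theorem level_eq_zero (ψ : ℕ → ℕ → ℝ) {N b : ℕ} (h : N < 2 * b) : level ψ N b = 0 :=
  if_neg (by omega)

theorem level_shift (ψ : ℕ → ℕ → ℝ) (m N b : ℕ) :
    level (fun b k => ψ (b + m) k) N b = level ψ (N + 2 * m) (b + m) := by
  unfold level
  by_cases h : 2 * b ≤ N
  · rw [if_pos h, if_pos (by omega)]
    congr 1
    omega
  · rw [if_neg h, if_neg (by omega)]

/-- The ballot number cannot be cancelled: for `2 * b = N + 1` the left level is zero while `level ψ
(N + 1) b` is the floor value `ψ b 0`. -/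
theorem IsHarmonic.ballotNumber_mul_level {ψ : ℕ → ℕ → ℝ} (h : IsHarmonic ψ) (N b : ℕ) :
    ballotNumber N b * level ψ N b =
      ballotNumber N b * (level ψ (N + 1) b + level ψ (N + 1) (b + 1)) := by
  rcases lt_trichotomy (2 * b) N with hb | hb | hb
  · obtain ⟨k, rfl⟩ : ∃ k, N = 2 * b + (k + 1) := ⟨N - 2 * b - 1, by omega⟩
    unfold level
    rw [if_pos (by omega), if_pos (by omega), if_pos (by omega),
      show 2 * b + (k + 1) - 2 * b = k + 1 by omega,
      show 2 * b + (k + 1) + 1 - 2 * b = k + 2 by omega,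
      show 2 * b + (k + 1) + 1 - 2 * (b + 1) = k by omega, h.succ]
  · subst hb
    rw [level_eq_zero ψ (show 2 * b + 1 < 2 * (b + 1) by omega)]
    unfold level
    rw [if_pos le_rfl, if_pos (by omega), Nat.sub_self, show 2 * b + 1 - 2 * b = 1 by omega,
      h.floor, add_zero]
  · rw [level_eq_zero ψ hb, level_eq_zero ψ (show N + 1 < 2 * (b + 1) by omega)]
    rcases Nat.lt_or_ge (N + 1) (2 * b) with h1 | h1
    · rw [level_eq_zero ψ h1, add_zero]
    · rw [ballotNumber_eq_zero (by omega)]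
      simp

/-- Pascal's rule for ballot numbers is adjoint to harmonicity, so the sum does not change with `N`.
-/
theorem IsHarmonic.sum_ballotNumber_mul_level {ψ : ℕ → ℕ → ℝ} (h : IsHarmonic ψ) (N : ℕ) :
    ∑ b ∈ Finset.range (N + 1), ballotNumber N b * level ψ N b = ψ 0 0 := by
  induction N with
  | zero => simp [ballotNumber, level]
  | succ N ih =>
    rw [← ih, Finset.sum_congr rfl fun b _ => h.ballotNumber_mul_level N b]
    simp only [mul_add, Finset.sum_add_distrib]
    have e : ∑ b ∈ Finset.range (N + 1), ballotNumber N b * level ψ (N + 1) b =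
        ∑ b ∈ Finset.range (N + 2), ballotNumber N b * level ψ (N + 1) b := by
      rw [Finset.sum_range_succ _ (N + 1), level_eq_zero ψ (by omega), mul_zero, add_zero]
    rw [e, Finset.sum_range_succ', Finset.sum_range_succ' _ (N + 1)]
    simp only [ballotNumber_succ_succ, add_mul, Finset.sum_add_distrib, ballotNumber_zero]
    ring

/-- The mass at time `M` of the vertex with `b` down-steps. -/
noncomputable def levelMass (ψ : ℕ → ℕ → ℝ) (M b : ℕ) : ℝ := ballotNumber M b * level ψ M b

theorem levelMass_eq_zero (ψ : ℕ → ℕ → ℝ) {N b : ℕ} (h : N < 2 * b) : levelMass ψ N b = 0 := by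
  rw [levelMass, level_eq_zero ψ h, mul_zero]

theorem levelMass_nonneg {ψ : ℕ → ℕ → ℝ} (h : ∀ b k, 0 ≤ ψ b k) (M b : ℕ) :
    0 ≤ levelMass ψ M b := by
  by_cases hb : 2 * b ≤ M
  · refine mul_nonneg (ballotNumber_nonneg hb) ?_
    rw [level, if_pos hb]
    exact h _ _
  · rw [levelMass_eq_zero ψ (by omega)]

/-- Conservation of mass for `ψ` restarted at the `m`-th floor vertex, with path counts rewritten
relative to the root. -/
theorem IsHarmonic.floor_eq_sum {ψ : ℕ → ℕ → ℝ} (h : IsHarmonic ψ) (m N : ℕ) :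
    ψ m 0 = ∑ B ∈ Finset.range (N + 2 * m + 1),
      (∏ i ∈ Finset.range m, shiftRatio i (N + 2 * m) B) * levelMass ψ (N + 2 * m) B := by
  have h0 := (h.shift m).sum_ballotNumber_mul_level N
  rw [zero_add] at h0
  -- The first `m` terms vanish because the factor `i = B` has numerator `B - B`; the last `m` lie
  -- below the floor.
  rw [show N + 2 * m + 1 = m + ((N + 1) + m) by ring, Finset.sum_range_add,
    Finset.sum_eq_zero, zero_add, Finset.sum_range_add _ (N + 1),
    Finset.sum_eq_zero (s := Finset.range m), add_zero, ← h0]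
  · refine Finset.sum_congr rfl fun b _ => ?_
    rw [level_shift, ballotNumber_eq_mul_prod m N b, levelMass, add_comm m b]
    ring
  · intro b _
    rw [levelMass_eq_zero ψ (by omega), mul_zero]
  · intro B hB
    rw [Finset.prod_eq_zero hB, zero_mul]
    simp [shiftRatio]

/-! ### Uniform asymptotics of the ratios. -/

/-- `f` and `g` differ by `O(1 / M)`, uniformly in the second argument `b ≤ M`. -/
def UniformlyClose (f g : ℕ → ℕ → ℝ) : Prop :=
  ∃ C : ℝ, ∃ M₀ : ℕ, 0 ≤ C ∧ ∀ M, M₀ ≤ M → ∀ b, b ≤ M → |f M b - g M b| ≤ C / M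

theorem UniformlyClose.mul {f g f' g' : ℕ → ℕ → ℝ} (h : UniformlyClose f g)
    (h' : UniformlyClose f' g') (hg : ∀ M b, b ≤ M → |g M b| ≤ 1)
    (hg' : ∀ M b, b ≤ M → |g' M b| ≤ 1) :
    UniformlyClose (fun M b => f M b * f' M b) fun M b => g M b * g' M b := by
  obtain ⟨C, M₀, hC, h⟩ := h
  obtain ⟨C', M₁, hC', h'⟩ := h'
  refine ⟨C * (C' + 1) + C', max (max M₀ M₁) 1, by positivity, fun M hM b hb => ?_⟩
  simp only [max_le_iff] at hM
  have h1 := h M hM.1.1 b hb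
  have h2 := h' M hM.1.2 b hb
  have hM1 : (1 : ℝ) ≤ M := by exact_mod_cast hM.2
  have h3 : |f' M b| ≤ C' + 1 := by
    have e : C' / M ≤ C' := div_le_self hC' hM1
    calc |f' M b| = |(f' M b - g' M b) + g' M b| := by ring_nf
      _ ≤ |f' M b - g' M b| + |g' M b| := abs_add_le _ _
      _ ≤ C' + 1 := by linarith [hg' M b hb]
  calc |f M b * f' M b - g M b * g' M b|
      = |(f M b - g M b) * f' M b + g M b * (f' M b - g' M b)| := by ring_nf
    _ ≤ |f M b - g M b| * |f' M b| + |g M b| * |f' M b - g' M b| := by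
        rw [← abs_mul, ← abs_mul]
        exact abs_add_le _ _
    _ ≤ C / M * (C' + 1) + 1 * (C' / M) := by
        gcongr
        exact hg M b hb
    _ = (C * (C' + 1) + C') / M := by ring

theorem abs_div_sub_div_le {x M c d : ℝ} (hx : 0 ≤ x) (hxM : x ≤ M) (hM : 0 < M)
    (hd : 2 * |d| ≤ M) : |(x + c) / (M + d) - x / M| ≤ 2 * (|c| + |d|) / M := by
  have h1 : M / 2 ≤ M + d := by linarith [neg_abs_le d]
  have h2 : 0 < M + d := by linarith
  rw [div_sub_div _ _ h2.ne' hM.ne', abs_div, abs_of_pos (mul_pos h2 hM),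
    div_le_div_iff₀ (mul_pos h2 hM) hM]
  have h3 : |(x + c) * M - (M + d) * x| ≤ M * (|c| + |d|) := by
    calc |(x + c) * M - (M + d) * x| = |M * c - x * d| := by ring_nf
      _ ≤ |M * c| + |x * d| := abs_sub _ _
      _ = M * |c| + x * |d| := by rw [abs_mul, abs_mul, abs_of_pos hM, abs_of_nonneg hx]
      _ ≤ M * |c| + M * |d| := by gcongr
      _ = M * (|c| + |d|) := by ring
  have h4 : 0 ≤ |c| + |d| := by positivity
  calc |(x + c) * M - (M + d) * x| * M ≤ M * (|c| + |d|) * M := by gcongr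
    _ = 2 * (|c| + |d|) * (M / 2 * M) := by ring
    _ ≤ 2 * (|c| + |d|) * ((M + d) * M) := by gcongr

theorem uniformlyClose_div {x : ℕ → ℕ → ℝ} (hx : ∀ M b, b ≤ M → 0 ≤ x M b ∧ x M b ≤ M)
    (c d : ℝ) : UniformlyClose (fun M b => (x M b + c) / (M + d)) fun M b => x M b / M := by
  refine ⟨2 * (|c| + |d|), ⌈2 * |d|⌉₊ + 1, by positivity, fun M hM b hb => ?_⟩
  have h1 : 2 * |d| ≤ M := (Nat.le_ceil _).trans (by exact_mod_cast (by omega))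
  have h2 : (0 : ℝ) < M := by exact_mod_cast (by omega)
  exact abs_div_sub_div_le (hx M b hb).1 (hx M b hb).2 h2 h1

theorem abs_div_le_one_of_mem {x M : ℝ} (hx : 0 ≤ x ∧ x ≤ M) : |x / M| ≤ 1 := by
  rw [abs_of_nonneg (div_nonneg hx.1 (hx.1.trans hx.2))]
  exact div_le_one_of_le₀ hx.2 (hx.1.trans hx.2)

theorem uniformlyClose_shiftRatio (i : ℕ) :
    UniformlyClose (shiftRatio i) fun M B => (B / M : ℝ) * ((M - B) / M) := by
  have hB : ∀ M B : ℕ, B ≤ M → (0 : ℝ) ≤ B ∧ (B : ℝ) ≤ M := fun M B h =>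
    ⟨Nat.cast_nonneg B, by exact_mod_cast h⟩
  have hMB : ∀ M B : ℕ, B ≤ M → (0 : ℝ) ≤ M - B ∧ (M : ℝ) - B ≤ M := fun M B h =>
    ⟨by linarith [(hB M B h).2], by linarith [(hB M B h).1]⟩
  exact (uniformlyClose_div hB _ _).mul (uniformlyClose_div hMB _ _)
    (fun M b h => abs_div_le_one_of_mem (hB M b h)) fun M b h => abs_div_le_one_of_mem (hMB M b h)

theorem uniformlyClose_prod_shiftRatio (m : ℕ) :
    UniformlyClose (fun M B => ∏ i ∈ Finset.range m, shiftRatio i M B)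
      fun M B => ((B / M : ℝ) * ((M - B) / M)) ^ m := by
  have hb : ∀ M B : ℕ, B ≤ M → |(B / M : ℝ) * ((M - B) / M)| ≤ 1 := fun M B h => by
    have h' : (B : ℝ) ≤ M := by exact_mod_cast h
    have h0 : (0 : ℝ) ≤ B := Nat.cast_nonneg B
    rw [abs_mul]
    exact mul_le_one₀ (abs_div_le_one_of_mem ⟨h0, h'⟩) (abs_nonneg _)
      (abs_div_le_one_of_mem ⟨by linarith, by linarith⟩)
  induction m with
  | zero => exact ⟨0, 0, le_rfl, fun M _ b _ => by simp⟩
  | succ m ih =>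
    simp only [Finset.prod_range_succ, pow_succ]
    refine ih.mul (uniformlyClose_shiftRatio m) (fun M b h => ?_) hb
    rw [abs_pow]
    exact pow_le_one₀ (abs_nonneg _) (hb M b h)

/-- The floor values of a normalized nonnegative harmonic function are limits of moments. -/
theorem IsHarmonic.tendsto_sum_pow {ψ : ℕ → ℕ → ℝ} (h : IsHarmonic ψ) (h0 : ∀ b k, 0 ≤ ψ b k)
    (h1 : ψ 0 0 = 1) (m : ℕ) :
    Filter.Tendsto (fun M : ℕ => ∑ B ∈ Finset.range (M + 1),
      levelMass ψ M B * ((B / M : ℝ) * ((M - B) / M)) ^ m) Filter.atTop (nhds (ψ m 0)) := by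
  obtain ⟨C, M₀, hC, hM₀⟩ := uniformlyClose_prod_shiftRatio m
  rw [tendsto_iff_dist_tendsto_zero]
  refine squeeze_zero' (.of_forall fun _ => dist_nonneg) ?_ (tendsto_const_div_atTop_nhds_zero_nat C)
  filter_upwards [Filter.eventually_ge_atTop (max M₀ (2 * m))] with M hM
  rw [max_le_iff] at hM
  obtain ⟨N, rfl⟩ : ∃ N, M = N + 2 * m := ⟨M - 2 * m, by omega⟩
  rw [h.floor_eq_sum m N, Real.dist_eq, ← Finset.sum_sub_distrib]
  set M := N + 2 * m
  -- The uniform error is averaged against masses of total `ψ 0 0 = 1`.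
  calc |∑ B ∈ Finset.range (M + 1), (levelMass ψ M B * ((B / M : ℝ) * ((M - B) / M)) ^ m -
        (∏ i ∈ Finset.range m, shiftRatio i M B) * levelMass ψ M B)|
      ≤ ∑ B ∈ Finset.range (M + 1), |levelMass ψ M B * ((B / M : ℝ) * ((M - B) / M)) ^ m -
        (∏ i ∈ Finset.range m, shiftRatio i M B) * levelMass ψ M B| :=
        Finset.abs_sum_le_sum_abs _ _
    _ ≤ ∑ B ∈ Finset.range (M + 1), levelMass ψ M B * (C / M) := by
        refine Finset.sum_le_sum fun B hB => ?_
        rw [mul_comm _ (levelMass ψ M B), ← mul_sub, abs_mul,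
          abs_of_nonneg (levelMass_nonneg h0 M B), abs_sub_comm]
        exact mul_le_mul_of_nonneg_left
          (hM₀ M hM.1 B (Nat.lt_succ_iff.1 (Finset.mem_range.1 hB))) (levelMass_nonneg h0 M B)
    _ = C / M := by
        rw [← Finset.sum_mul]
        simp only [levelMass]
        rw [h.sum_ballotNumber_mul_level, h1, one_mul]

/-! ### The limit law of the fraction of up-steps. -/

/-- The point of `[1/2, 1]` attached to the vertex with `b` down-steps at time `M`: the fraction
of up-steps. -/
noncomputable def upFraction (M b : ℕ) : Set.Icc (1 / 2 : ℝ) 1 :=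
  Set.projIcc (1 / 2) 1 (by norm_num) (1 - b / M)

theorem coe_upFraction {M b : ℕ} (h : 2 * b ≤ M) : (upFraction M b : ℝ) = 1 - b / M := by
  have h' : (2 : ℝ) * b ≤ M := by exact_mod_cast h
  have h0 : (0 : ℝ) ≤ b / M := by positivity
  have h1 : (b / M : ℝ) ≤ 1 / 2 := div_le_of_le_mul₀ (by positivity) (by norm_num) (by linarith)
  rw [upFraction, Set.projIcc_of_mem _ ⟨by linarith, by linarith⟩]

/-- The law at time `M` of the fraction of up-steps. -/
noncomputable def fractionLaw (ψ : ℕ → ℕ → ℝ) (M : ℕ) : Measure (Set.Icc (1 / 2 : ℝ) 1) :=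
  ∑ B ∈ Finset.range (M + 1), ENNReal.ofReal (levelMass ψ M B) • Measure.dirac (upFraction M B)

theorem isProbabilityMeasure_fractionLaw {ψ : ℕ → ℕ → ℝ} (h : IsHarmonic ψ)
    (h0 : ∀ b k, 0 ≤ ψ b k) (h1 : ψ 0 0 = 1) (M : ℕ) :
    IsProbabilityMeasure (fractionLaw ψ M) := by
  refine ⟨?_⟩
  simp only [fractionLaw, Measure.finsetSum_apply, Measure.smul_apply, measure_univ, smul_eq_mul,
    mul_one]
  rw [← ENNReal.ofReal_sum_of_nonneg fun B _ => levelMass_nonneg h0 M B]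
  simp only [levelMass]
  rw [h.sum_ballotNumber_mul_level, h1, ENNReal.ofReal_one]

theorem integral_fractionLaw {ψ : ℕ → ℕ → ℝ} (h0 : ∀ b k, 0 ≤ ψ b k) (M : ℕ)
    (f : Set.Icc (1 / 2 : ℝ) 1 → ℝ) :
    ∫ lam, f lam ∂fractionLaw ψ M =
      ∑ B ∈ Finset.range (M + 1), levelMass ψ M B * f (upFraction M B) := by
  rw [fractionLaw, integral_finsetSum_measure]
  · refine Finset.sum_congr rfl fun B _ => ?_
    rw [integral_smul_measure, integral_dirac, ENNReal.toReal_ofReal (levelMass_nonneg h0 M B),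
      smul_eq_mul]
  · intro B _
    exact (integrable_dirac (by simp)).smul_measure ENNReal.ofReal_ne_top

theorem IsHarmonic.tendsto_integral_fractionLaw {ψ : ℕ → ℕ → ℝ} (h : IsHarmonic ψ)
    (h0 : ∀ b k, 0 ≤ ψ b k) (h1 : ψ 0 0 = 1) (m : ℕ) :
    Filter.Tendsto (fun M => ∫ lam, ((lam : ℝ) * (1 - lam)) ^ m ∂fractionLaw ψ M)
      Filter.atTop (nhds (ψ m 0)) := by
  refine (h.tendsto_sum_pow h0 h1 m).congr' ?_
  filter_upwards [Filter.eventually_gt_atTop 0] with M hM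
  rw [integral_fractionLaw h0]
  refine Finset.sum_congr rfl fun B _ => ?_
  -- The projection onto `[1/2, 1]` can only matter where the mass is zero.
  by_cases hB : 2 * B ≤ M
  · have hM' : (M : ℝ) ≠ 0 := by exact_mod_cast hM.ne'
    rw [coe_upFraction hB]
    congr 2
    field_simp
    ring
  · rw [levelMass_eq_zero ψ (by omega), zero_mul, zero_mul]

/-- The floor values of a normalized nonnegative harmonic function are moments of a probability
measure on `[1/2, 1]`. -/
theorem IsHarmonic.exists_floor_eq_integral {ψ : ℕ → ℕ → ℝ} (h : IsHarmonic ψ)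
    (h0 : ∀ b k, 0 ≤ ψ b k) (h1 : ψ 0 0 = 1) :
    ∃ μ : Measure (Set.Icc (1 / 2 : ℝ) 1), IsProbabilityMeasure μ ∧
      ∀ m, ψ m 0 = ∫ lam, ((lam : ℝ) * (1 - lam)) ^ m ∂μ := by
  let P : ℕ → ProbabilityMeasure (Set.Icc (1 / 2 : ℝ) 1) := fun M =>
    ⟨fractionLaw ψ M, isProbabilityMeasure_fractionLaw h h0 h1 M⟩
  -- An ultrafilter limit replaces a convergent subsequence; the moments already converge along
  -- `atTop`, so any limit point serves.
  obtain ⟨μ, -, hμ⟩ := isCompact_univ.ultrafilter_le_nhds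
    ((Filter.hyperfilter ℕ).map P) (by simp)
  have hμ' : Filter.Tendsto P (Filter.hyperfilter ℕ : Filter ℕ) (nhds μ) := hμ
  refine ⟨μ, μ.2, fun m => ?_⟩
  rw [ProbabilityMeasure.tendsto_iff_forall_integral_tendsto] at hμ'
  let f : BoundedContinuousFunction (Set.Icc (1 / 2 : ℝ) 1) ℝ :=
    BoundedContinuousFunction.mkOfCompact
      ⟨fun lam => ((lam : ℝ) * (1 - lam)) ^ m, by fun_prop⟩
  refine tendsto_nhds_unique ?_ (hμ' f)
  refine (h.tendsto_integral_fractionLaw h0 h1 m).mono_left ?_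
  rw [← Nat.cofinite_eq_atTop]
  exact Filter.hyperfilter_le_cofinite

/-! ### Path weights of the chains. -/

/-- The common probability under the chain with parameter `lam` of the paths with `b` down-steps
that end at height `k`. -/
noncomputable def pathWeight (lam : ℝ) (b k : ℕ) : ℝ :=
  (lam * (1 - lam)) ^ b * ∑ j ∈ Finset.range (k + 1), lam ^ j * (1 - lam) ^ (k - j)

theorem sum_succ_eq (x y : ℝ) (k : ℕ) :
    ∑ j ∈ Finset.range (k + 2), x ^ j * y ^ (k + 1 - j) =
      x ^ (k + 1) + y * ∑ j ∈ Finset.range (k + 1), x ^ j * y ^ (k - j) := by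
  have := geom_sum₂_succ_eq x y (n := k + 1)
  simpa using this

/-- The sums are the complete homogeneous polynomials `h_k(x, y)`, which satisfy `(x + y) * h_(k+1)
= h_(k+2) + x * y * h_k`; here `x + y = 1`. -/
theorem isHarmonic_pathWeight (lam : ℝ) : IsHarmonic (pathWeight lam) := by
  refine ⟨fun b => ?_, fun b k => ?_⟩
  · simp [pathWeight, Finset.sum_range_succ]
  · simp only [pathWeight]
    rw [sum_succ_eq, sum_succ_eq, sum_succ_eq]
    ring

theorem continuous_pathWeight (b k : ℕ) : Continuous fun lam => pathWeight lam b k := by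
  unfold pathWeight
  fun_prop

theorem pathWeight_nonneg {lam : ℝ} (h : lam ∈ Set.Icc (1 / 2 : ℝ) 1) (b k : ℕ) :
    0 ≤ pathWeight lam b k := by
  have h1 : 0 ≤ lam := by linarith [h.1]
  have h2 : 0 ≤ 1 - lam := by linarith [h.2]
  unfold pathWeight
  positivity

theorem integrable_pathWeight (μ : Measure (Set.Icc (1 / 2 : ℝ) 1)) [IsFiniteMeasure μ]
    (b k : ℕ) : Integrable (fun lam : Set.Icc (1 / 2 : ℝ) 1 => pathWeight lam b k) μ := by
  have hc : Continuous fun lam : Set.Icc (1 / 2 : ℝ) 1 => pathWeight lam b k :=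
    (continuous_pathWeight b k).comp continuous_subtype_val
  exact hc.integrable_of_hasCompactSupport (HasCompactSupport.of_compactSpace _)

/-- A normalized nonnegative harmonic function is a mixture of the functions `pathWeight lam`. -/
theorem IsHarmonic.exists_eq_integral_pathWeight {ψ : ℕ → ℕ → ℝ} (h : IsHarmonic ψ)
    (h0 : ∀ b k, 0 ≤ ψ b k) (h1 : ψ 0 0 = 1) :
    ∃ μ : Measure (Set.Icc (1 / 2 : ℝ) 1), IsProbabilityMeasure μ ∧
      ∀ b k, ψ b k = ∫ lam : Set.Icc (1 / 2 : ℝ) 1, pathWeight lam b k ∂μ := by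
  obtain ⟨μ, hμ, hm⟩ := h.exists_floor_eq_integral h0 h1
  refine ⟨μ, hμ, fun b k => h.eq_of_floor
    (φ := fun b k => ∫ lam : Set.Icc (1 / 2 : ℝ) 1, pathWeight lam b k ∂μ)
    ⟨fun b => ?_, fun b k => ?_⟩ (fun b => ?_) k b⟩
  · simp only [(isHarmonic_pathWeight _).floor b]
  · simp only [(isHarmonic_pathWeight _).succ b k]
    exact integral_add (integrable_pathWeight μ _ _) (integrable_pathWeight μ _ _)
  · rw [hm]
    simp [pathWeight]

/-- The up-probability is `h_(k+1) / h_k`: a geometric sum away from `1/2`, and at `1/2` a sum of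
equal terms. -/
theorem upProb_mul_sum (lam : ℝ) (h : lam ∈ Set.Icc (1 / 2 : ℝ) 1) (k : ℕ) :
    upProb lam k * ∑ j ∈ Finset.range (k + 1), lam ^ j * (1 - lam) ^ (k - j) =
      ∑ j ∈ Finset.range (k + 2), lam ^ j * (1 - lam) ^ (k + 1 - j) := by
  by_cases hl : lam = 1 / 2
  · have e : ∀ n : ℕ, ∑ j ∈ Finset.range (n + 1), lam ^ j * (1 - lam) ^ (n - j) =
        ((n : ℝ) + 1) * (1 / 2) ^ n := fun n => by
      rw [hl, show (1 - 1 / 2 : ℝ) = 1 / 2 by norm_num]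
      rw [Finset.sum_congr rfl (g := fun _ => (1 / 2 : ℝ) ^ n) fun j hj => by
        rw [← pow_add, Nat.add_sub_cancel' (Nat.lt_succ_iff.1 (Finset.mem_range.1 hj))]]
      simp
    rw [e, e (k + 1), upProb, if_pos hl]
    have hk : (k : ℝ) + 1 ≠ 0 := by positivity
    push_cast
    field_simp
    ring
  · have hpos : 0 < lam - (1 - lam) := by
      have := lt_of_le_of_ne h.1 (Ne.symm hl)
      linarith
    have e : ∀ n : ℕ, (∑ j ∈ Finset.range (n + 1), lam ^ j * (1 - lam) ^ (n - j)) *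
        (lam - (1 - lam)) = lam ^ (n + 1) - (1 - lam) ^ (n + 1) := fun n =>
      (Commute.all lam (1 - lam)).geom_sum₂_mul (n + 1)
    have hne : (1 - lam) ^ (k + 1) - lam ^ (k + 1) ≠ 0 := by
      have : (1 - lam) ^ (k + 1) < lam ^ (k + 1) :=
        pow_lt_pow_left₀ (by linarith) (by linarith [h.2]) (by omega)
      linarith
    apply mul_right_cancel₀ hpos.ne'
    rw [mul_assoc, e, e (k + 1), upProb, if_neg hl, div_mul_eq_mul_div, div_eq_iff hne]
    ring

theorem upProb_zero {lam : ℝ} (h : lam ∈ Set.Icc (1 / 2 : ℝ) 1) : upProb lam 0 = 1 := by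
  have := upProb_mul_sum lam h 0
  simpa [Finset.sum_range_succ] using this

theorem pathWeight_mul_upProb {lam : ℝ} (h : lam ∈ Set.Icc (1 / 2 : ℝ) 1) (b k : ℕ) :
    upProb lam k * pathWeight lam b k = pathWeight lam b (k + 1) := by
  rw [pathWeight, pathWeight, ← upProb_mul_sum lam h]
  ring

theorem pathWeight_mul_one_sub_upProb {lam : ℝ} (h : lam ∈ Set.Icc (1 / 2 : ℝ) 1) (b k : ℕ) :
    (1 - upProb lam (k + 1)) * pathWeight lam b (k + 1) = pathWeight lam (b + 1) k := by
  have := (isHarmonic_pathWeight lam).succ b k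
  rw [sub_mul, pathWeight_mul_upProb h]
  linarith

/-! ### The law of the chain on cylinders. -/

/-- The law of the Markov chain with parameter `lam` on all sequences in `ℕ × ℕ`. -/
noncomputable def sequenceLaw (lam : Set.Icc (1 / 2 : ℝ) 1) : Measure (ℕ → ℕ × ℕ) :=
  Kernel.trajMeasure (X := fun _ => ℕ × ℕ) (Measure.dirac (0, 0)) (historyKernel lam)

instance isProbabilityMeasure_sequenceLaw (lam : Set.Icc (1 / 2 : ℝ) 1) :
    IsProbabilityMeasure (sequenceLaw lam) := by
  unfold sequenceLaw
  infer_instance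

theorem sequenceLaw_compProd (lam : Set.Icc (1 / 2 : ℝ) 1) (n : ℕ) :
    (sequenceLaw lam).map (Preorder.frestrictLe n) ⊗ₘ historyKernel lam n =
      (sequenceLaw lam).map fun x => (Preorder.frestrictLe n x, x (n + 1)) :=
  Kernel.map_frestrictLe_trajMeasure_compProd_eq_map_trajMeasure
    (X := fun _ => ℕ × ℕ)

theorem sequenceLaw_start (lam : Set.Icc (1 / 2 : ℝ) 1) :
    sequenceLaw lam {x | x 0 = (0, 0)} = 1 := by
  have hm : MeasurableSet {x : ℕ → ℕ × ℕ | x 0 = (0, 0)} :=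
    measurableSet_eq_fun (measurable_pi_apply 0) measurable_const
  rw [sequenceLaw, Kernel.trajMeasure, Measure.map_dirac' (by fun_prop),
    Measure.dirac_bind (Kernel.measurable _)]
  set x₀ : (i : Finset.Iic 0) → ℕ × ℕ :=
    (MeasurableEquiv.piUnique fun _ : Finset.Iic 0 => ℕ × ℕ).symm (0, 0) with hx₀
  have h1 := Kernel.traj_map_frestrictLe_apply (X := fun _ => ℕ × ℕ) (κ := historyKernel lam) 0 0 x₀
  rw [Kernel.partialTraj_self, Kernel.id_apply] at h1
  have h2 := congrArg (fun m => m {x₀}) h1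
  rw [Measure.map_apply (by fun_prop) (measurableSet_singleton _),
    Measure.dirac_apply' _ (measurableSet_singleton _)] at h2
  simp only [Set.mem_singleton_iff, Set.indicator_of_mem, Pi.one_apply] at h2
  refine le_antisymm prob_le_one (h2.symm.le.trans (measure_mono ?_))
  intro x hx
  have := congrFun (Set.mem_singleton_iff.1 hx) ⟨0, Finset.mem_Iic.2 le_rfl⟩
  exact this

theorem stepKernel_apply (lam : Set.Icc (1 / 2 : ℝ) 1) (p : ℕ × ℕ) (s : Set (ℕ × ℕ)) :
    stepKernel lam p s =
      ENNReal.ofReal (upProb lam p.2) * s.indicator 1 (p.1 + 1, p.2 + 1) +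
        ENNReal.ofReal (1 - upProb lam p.2) * s.indicator 1 (p.1 + 1, p.2 - 1) := by
  change (ENNReal.ofReal (upProb lam p.2) • Measure.dirac (p.1 + 1, p.2 + 1) +
      ENNReal.ofReal (1 - upProb lam p.2) • Measure.dirac (p.1 + 1, p.2 - 1)) s = _
  simp

theorem stepKernel_not_isStep (lam : Set.Icc (1 / 2 : ℝ) 1) (p : ℕ × ℕ) :
    stepKernel lam p {q | ¬ IsStep p q} = 0 := by
  rw [stepKernel_apply, Set.indicator_of_notMem, mul_zero, zero_add]
  -- On the floor, truncated subtraction gives an illegal target, but its weight is zero.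
  · rcases Nat.eq_zero_or_pos p.2 with h | h
    · rw [h, upProb_zero lam.2]
      simp
    · rw [Set.indicator_of_notMem, mul_zero]
      simp only [IsStep, Set.mem_ofPred_eq, not_not]
      exact ⟨trivial, .inr (Nat.sub_add_cancel h)⟩
  · simp [IsStep]

theorem ae_mem_infinitePaths (lam : Set.Icc (1 / 2 : ℝ) 1) :
    ∀ᵐ x ∂sequenceLaw lam, x ∈ infinitePaths := by
  have h0 : ∀ᵐ x ∂sequenceLaw lam, x 0 = (0, 0) := by
    have hm : MeasurableSet {x : ℕ → ℕ × ℕ | x 0 = (0, 0)} :=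
      measurableSet_eq_fun (measurable_pi_apply 0) measurable_const
    exact (prob_compl_eq_zero_iff hm).2 (sequenceLaw_start lam)
  have hs : ∀ n, ∀ᵐ x ∂sequenceLaw lam, IsStep (x n) (x (n + 1)) := fun n => by
    have hm : MeasurableSet {z : (Finset.Iic n → ℕ × ℕ) × (ℕ × ℕ) |
        ¬ IsStep (z.1 ⟨n, Finset.mem_Iic.2 le_rfl⟩) z.2} := by
      have : Measurable fun z : (Finset.Iic n → ℕ × ℕ) × (ℕ × ℕ) =>
          (z.1 ⟨n, Finset.mem_Iic.2 le_rfl⟩, z.2) := by fun_prop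
      exact this (MeasurableSet.of_discrete (s := {w : (ℕ × ℕ) × (ℕ × ℕ) | ¬ IsStep w.1 w.2}))
    have h := congrArg (fun m => m {z : (Finset.Iic n → ℕ × ℕ) × (ℕ × ℕ) |
        ¬ IsStep (z.1 ⟨n, Finset.mem_Iic.2 le_rfl⟩) z.2}) (sequenceLaw_compProd lam n)
    rw [Measure.map_apply (by fun_prop) hm, Measure.compProd_apply hm] at h
    refine (h.symm.trans ?_ : _ = _)
    rw [lintegral_eq_zero_of_ae_eq_zero]
    exact .of_forall fun y => stepKernel_not_isStep lam (y ⟨n, Finset.mem_Iic.2 le_rfl⟩)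
  filter_upwards [h0, ae_all_iff.2 hs] with x hx0 hxs using ⟨hx0, hxs⟩

theorem sequenceLaw_cylinder_succ (lam : Set.Icc (1 / 2 : ℝ) 1) (v : ℕ → ℕ × ℕ) (n : ℕ) :
    sequenceLaw lam {x | ∀ i ≤ n + 1, x i = v i} =
      stepKernel lam (v n) {v (n + 1)} * sequenceLaw lam {x | ∀ i ≤ n, x i = v i} := by
  have hm : MeasurableSet ({Preorder.frestrictLe n v} : Set (Finset.Iic n → ℕ × ℕ)) :=
    measurableSet_singleton _
  have h := congrArg (fun m => m ({Preorder.frestrictLe n v} ×ˢ {v (n + 1)}))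
    (sequenceLaw_compProd lam n)
  rw [Measure.map_apply (by fun_prop) (hm.prod (measurableSet_singleton _)),
    Measure.compProd_apply_prod hm (measurableSet_singleton _), lintegral_singleton,
    Measure.map_apply (by fun_prop) hm] at h
  have e : ∀ x : ℕ → ℕ × ℕ, Preorder.frestrictLe (π := fun _ => ℕ × ℕ) n x =
      Preorder.frestrictLe (π := fun _ => ℕ × ℕ) n v ↔ ∀ i ≤ n, x i = v i := fun x =>
    ⟨fun hx i hi => congrFun hx ⟨i, Finset.mem_Iic.2 hi⟩,
      fun hx => funext fun i => hx i (Finset.mem_Iic.1 i.2)⟩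
  have e1 : (fun x : ℕ → ℕ × ℕ => (Preorder.frestrictLe (π := fun _ => ℕ × ℕ) n x, x (n + 1))) ⁻¹'
      ({Preorder.frestrictLe n v} ×ˢ {v (n + 1)}) = {x | ∀ i ≤ n + 1, x i = v i} := by
    ext x
    simp only [Set.mem_preimage, Set.mem_prod, Set.mem_singleton_iff, e, Set.mem_ofPred_eq]
    exact ⟨fun hx i hi => (Nat.le_succ_iff.1 hi).elim (hx.1 i) fun hi => hi ▸ hx.2,
      fun hx => ⟨fun i hi => hx i (by omega), hx _ le_rfl⟩⟩
  have e2 : Preorder.frestrictLe (π := fun _ => ℕ × ℕ) n ⁻¹' {Preorder.frestrictLe n v} =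
      {x | ∀ i ≤ n, x i = v i} := by
    ext x
    simp only [Set.mem_preimage, Set.mem_singleton_iff, e, Set.mem_ofPred_eq]
  rw [e1, e2] at h
  exact h.symm

/-- The vertices of a ballot path have coordinates `(2 * b + k, k)`. -/
theorem exists_downs (ω : InfinitePath) (n : ℕ) :
    (ω.1 n).1 = n ∧ ∃ b, n = 2 * b + (ω.1 n).2 := by
  induction n with
  | zero => rw [ω.2.1]; exact ⟨rfl, 0, rfl⟩
  | succ n ih =>
    obtain ⟨h1, b, hb⟩ := ih
    obtain ⟨h2, h3 | h3⟩ := ω.2.2 n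
    · exact ⟨by omega, b, by omega⟩
    · exact ⟨by omega, b + 1, by omega⟩

/-- Each transition probability is a quotient of consecutive path weights, so the product along a
path telescopes. -/
theorem sequenceLaw_cylinder (lam : Set.Icc (1 / 2 : ℝ) 1) (ω : InfinitePath) (n b : ℕ)
    (hb : n = 2 * b + (ω.1 n).2) :
    sequenceLaw lam {x | ∀ i ≤ n, x i = ω.1 i} = ENNReal.ofReal (pathWeight lam b (ω.1 n).2) := by
  induction n generalizing b with
  | zero =>
    obtain rfl : b = 0 := by omega
    have h := ω.2.1
    simp only [Nat.le_zero_eq, forall_eq, h]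
    rw [sequenceLaw_start]
    simp [pathWeight]
  | succ n ih =>
    obtain ⟨h1, c, hc⟩ := exists_downs ω n
    obtain ⟨h2, h3 | h3⟩ := ω.2.2 n
    · obtain rfl : b = c := by omega
      have e : ω.1 (n + 1) = ((ω.1 n).1 + 1, (ω.1 n).2 + 1) := Prod.ext h2 h3
      rw [sequenceLaw_cylinder_succ, ih b hc, stepKernel_apply, e, Set.indicator_of_mem (Set.mem_singleton _),
        Set.indicator_of_notMem (by simp), mul_zero, add_zero, Pi.one_apply, mul_one,
        ← ENNReal.ofReal_mul (upProb_mem lam.2 _).1, pathWeight_mul_upProb lam.2]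
    · obtain rfl : b = c + 1 := by omega
      have e : ω.1 (n + 1) = ((ω.1 n).1 + 1, (ω.1 n).2 - 1) := Prod.ext h2 (by simp; omega)
      rw [sequenceLaw_cylinder_succ, ih c hc, stepKernel_apply, ← e, Set.indicator_of_mem (Set.mem_singleton _),
        Set.indicator_of_notMem (by rw [e]; simp; omega), mul_zero, zero_add, Pi.one_apply,
        mul_one, ← h3,
        ← ENNReal.ofReal_mul (sub_nonneg.2 (upProb_mem lam.2 _).2),
        pathWeight_mul_one_sub_upProb lam.2]

theorem measurableSet_infinitePaths : MeasurableSet infinitePaths := by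
  have h0 : MeasurableSet {x : ℕ → ℕ × ℕ | x 0 = (0, 0)} :=
    measurableSet_eq_fun (measurable_pi_apply 0) measurable_const
  have hstep : ∀ n, MeasurableSet {x : ℕ → ℕ × ℕ | IsStep (x n) (x (n + 1))} := fun n => by
    have : Measurable fun x : ℕ → ℕ × ℕ => (x n, x (n + 1)) := by fun_prop
    exact this (MeasurableSet.of_discrete (s := {w : (ℕ × ℕ) × (ℕ × ℕ) | IsStep w.1 w.2}))
  have e : infinitePaths = {x : ℕ → ℕ × ℕ | x 0 = (0, 0)} ∩
      ⋂ n, {x : ℕ → ℕ × ℕ | IsStep (x n) (x (n + 1))} := by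
    ext x
    simp [infinitePaths]
  rw [e]
  exact h0.inter (.iInter hstep)

/-! ### Cylinders and measurability in the parameter. -/

/-- The set of infinite ballot paths that agree with `ω` up to time `n`. -/
def pathCylinder (ω : InfinitePath) (n : ℕ) : Set InfinitePath := {η | ∀ i ≤ n, η.1 i = ω.1 i}

theorem chainLaw_preimage (lam : Set.Icc (1 / 2 : ℝ) 1) (s : Set (ℕ → ℕ × ℕ)) :
    chainLaw lam (Subtype.val ⁻¹' s) = sequenceLaw lam s := by
  have he : MeasurableEmbedding (Subtype.val : InfinitePath → ℕ → ℕ × ℕ) :=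
    .subtype_coe measurableSet_infinitePaths
  change (sequenceLaw lam).comap Subtype.val _ = _
  rw [he.comap_apply, Subtype.image_preimage_coe]
  refine measure_congr ?_
  filter_upwards [ae_mem_infinitePaths lam] with x hx
  exact propext ⟨fun h => h.2, fun h => ⟨hx, h⟩⟩

instance isProbabilityMeasure_chainLaw (lam : Set.Icc (1 / 2 : ℝ) 1) :
    IsProbabilityMeasure (chainLaw lam) :=
  ⟨by rw [← Set.preimage_univ, chainLaw_preimage lam, measure_univ]⟩

theorem measurableSet_sequenceCylinder (v : ℕ → ℕ × ℕ) (n : ℕ) :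
    MeasurableSet {x : ℕ → ℕ × ℕ | ∀ i ≤ n, x i = v i} := by
  simp only [Set.ofPred_forall]
  exact .iInter fun i => .iInter fun _ => measurableSet_eq_fun (measurable_pi_apply i) measurable_const

theorem chainLaw_pathCylinder (lam : Set.Icc (1 / 2 : ℝ) 1) (ω : InfinitePath) (n b : ℕ)
    (hb : n = 2 * b + (ω.1 n).2) :
    chainLaw lam (pathCylinder ω n) = ENNReal.ofReal (pathWeight lam b (ω.1 n).2) := by
  rw [← sequenceLaw_cylinder lam ω n b hb,
    ← chainLaw_preimage lam]
  rfl

theorem measurableSet_pathCylinder (ω : InfinitePath) (n : ℕ) :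
    MeasurableSet (pathCylinder ω n) :=
  measurable_subtype_coe (measurableSet_sequenceCylinder ω.1 n)

theorem mem_pathCylinder_self (ω : InfinitePath) (n : ℕ) : ω ∈ pathCylinder ω n := fun _ _ => rfl

theorem pathCylinder_eq_of_mem {ω η : InfinitePath} {n : ℕ} (h : η ∈ pathCylinder ω n) :
    pathCylinder η n = pathCylinder ω n := by
  ext x
  exact ⟨fun hx i hi => (hx i hi).trans (h i hi), fun hx i hi => (hx i hi).trans (h i hi).symm⟩

theorem pathCylinder_anti (ω : InfinitePath) {m n : ℕ} (h : m ≤ n) :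
    pathCylinder ω n ⊆ pathCylinder ω m := fun _ hx i hi => hx i (hi.trans h)

/-- The collection of all path cylinders. -/
def pathCylinders : Set (Set InfinitePath) := {s | ∃ ω n, s = pathCylinder ω n}

/-- Two cylinders that meet are nested. -/
theorem isPiSystem_pathCylinders : IsPiSystem pathCylinders := by
  rintro _ ⟨ω, m, rfl⟩ _ ⟨η, n, rfl⟩ ⟨x, hx, hx'⟩
  rw [← pathCylinder_eq_of_mem hx, ← pathCylinder_eq_of_mem hx']
  refine ⟨x, max m n, Set.Subset.antisymm (fun y hy i hi => ?_)
    (Set.subset_inter (pathCylinder_anti x (le_max_left m n))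
      (pathCylinder_anti x (le_max_right m n)))⟩
  exact (le_max_iff.1 hi).elim (hy.1 i) (hy.2 i)

theorem countable_range_pathCylinder (n : ℕ) :
    (Set.range fun ω : InfinitePath => pathCylinder ω n).Countable := by
  let r : InfinitePath → (Fin (n + 1) → ℕ × ℕ) := fun ω i => ω.1 i
  let g : (Fin (n + 1) → ℕ × ℕ) → Set InfinitePath := fun v => {η | ∀ i : Fin (n + 1), η.1 i = v i}
  refine (Set.countable_range g).mono ?_
  rintro _ ⟨ω, rfl⟩
  refine ⟨r ω, ?_⟩
  ext η
  exact ⟨fun h i hi => h ⟨i, Nat.lt_succ_iff.2 hi⟩, fun h i => h i (Nat.lt_succ_iff.1 i.2)⟩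

theorem generateFrom_pathCylinders :
    (inferInstance : MeasurableSpace InfinitePath) = MeasurableSpace.generateFrom pathCylinders := by
  refine le_antisymm ?_ (MeasurableSpace.generateFrom_le ?_)
  · refine Measurable.comap_le ?_
    refine @measurable_pi_lambda _ _ _ (MeasurableSpace.generateFrom pathCylinders) _ _ fun n => ?_
    refine @measurable_to_countable' _ _ _ _ (MeasurableSpace.generateFrom pathCylinders) _ fun p => ?_
    have e : (fun ω : InfinitePath => ω.1 n) ⁻¹' {p} =
        ⋃₀ ((Set.range fun ω : InfinitePath => pathCylinder ω n) ∩
          {s | s ⊆ (fun ω : InfinitePath => ω.1 n) ⁻¹' {p}}) := by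
      refine Set.Subset.antisymm (fun ω hω => ?_) (Set.sUnion_subset fun s hs => hs.2)
      exact ⟨pathCylinder ω n, ⟨⟨ω, rfl⟩, fun η hη => (hη n le_rfl).trans hω⟩,
        mem_pathCylinder_self ω n⟩
    rw [e]
    refine @MeasurableSet.sUnion _ (MeasurableSpace.generateFrom pathCylinders) _
      ((countable_range_pathCylinder n).mono Set.inter_subset_left) ?_
    rintro _ ⟨⟨ω, rfl⟩, -⟩
    exact MeasurableSpace.measurableSet_generateFrom ⟨ω, n, rfl⟩
  · rintro _ ⟨ω, n, rfl⟩
    exact measurableSet_pathCylinder ω n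

/-- On the generating π-system the mass is a continuous function of the parameter. -/
theorem measurable_chainLaw : Measurable chainLaw := by
  refine .measure_of_isPiSystem_of_isProbabilityMeasure generateFrom_pathCylinders
    isPiSystem_pathCylinders ?_
  rintro _ ⟨ω, n, rfl⟩
  obtain ⟨-, b, hb⟩ := exists_downs ω n
  simp only [fun lam => chainLaw_pathCylinder lam ω n b hb]
  exact ((continuous_pathWeight b _).measurable.comp measurable_subtype_coe).ennreal_ofReal

/-! ### From central measures to harmonic functions. -/

theorem IsCentral.pathCylinder_eq {ν : Measure InfinitePath} (h : IsCentral ν)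
    {ω η : InfinitePath} {n : ℕ} (hn : (ω.1 n).2 = (η.1 n).2) :
    ν (pathCylinder ω n) = ν (pathCylinder η n) := by
  have key : ∀ ξ : InfinitePath, ν (pathCylinder ξ n) =
      ν {x | x.1 n = (n, (ξ.1 n).2)} / ((pathsTo n (ξ.1 n).2).ncard : ENNReal) := fun ξ => by
    rw [← h n (ξ.1 n).2 (fun i => ξ.1 i)
      ⟨ξ.2.1, Prod.ext (exists_downs ξ n).1 rfl, fun i => ξ.2.2 i⟩]
    congr 1
    ext x
    exact ⟨fun hx i => hx i (Nat.lt_succ_iff.1 i.2), fun hx i hi => hx ⟨i, Nat.lt_succ_iff.2 hi⟩⟩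
  rw [key ω, key η, hn]

/-- The path that makes `b` excursions of length two, then climbs forever. -/
def climbPath (b : ℕ) : InfinitePath :=
  ⟨fun i => (i, if i ≤ 2 * b then i % 2 else i - 2 * b), by simp, fun i => by
    refine ⟨rfl, ?_⟩
    dsimp only
    split_ifs <;> omega⟩

theorem climbPath_apply (b i : ℕ) :
    (climbPath b).1 i = (i, if i ≤ 2 * b then i % 2 else i - 2 * b) := rfl

theorem climbPath_height (b k : ℕ) : ((climbPath b).1 (2 * b + k)).2 = k := by
  rw [climbPath_apply]
  dsimp only
  split_ifs <;> omega

/-- The path that makes `b` excursions of length two, climbs to height `k + 1`, makes one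
down-step, then climbs forever. -/
def dipPath (b k : ℕ) : InfinitePath :=
  ⟨fun i => if i ≤ 2 * b + (k + 1) then (climbPath b).1 i else (i, i - 2 * b - 2), by
    simp [climbPath_apply], fun i => by
    simp only [climbPath_apply, IsStep]
    split_ifs <;> dsimp only <;> omega⟩

theorem dipPath_apply (b k i : ℕ) : (dipPath b k).1 i =
    if i ≤ 2 * b + (k + 1) then (climbPath b).1 i else (i, i - 2 * b - 2) := rfl

/-- The `ν`-probability of the path cylinders of the vertex `(2 * b + k, k)`. -/
noncomputable def vertexWeight (ν : Measure InfinitePath) (b k : ℕ) : ℝ :=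
  ν.real (pathCylinder (climbPath b) (2 * b + k))

theorem IsCentral.measure_pathCylinder {ν : Measure InfinitePath} [IsFiniteMeasure ν]
    (h : IsCentral ν) (ω : InfinitePath) (n b : ℕ) (hb : n = 2 * b + (ω.1 n).2) :
    ν.real (pathCylinder ω n) = vertexWeight ν b (ω.1 n).2 := by
  rw [vertexWeight, measureReal_def, measureReal_def, ← hb, h.pathCylinder_eq]
  conv_rhs => rw [hb]
  rw [climbPath_height]

/-- A cylinder splits according to the next step, which is forced on the floor. Centrality enters
only to replace `dipPath b k` by `climbPath (b + 1)`, which reaches the same vertex. -/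
theorem IsCentral.isHarmonic_vertexWeight {ν : Measure InfinitePath} [IsFiniteMeasure ν]
    (h : IsCentral ν) : IsHarmonic (vertexWeight ν) := by
  refine ⟨fun b => ?_, fun b k => ?_⟩
  · rw [vertexWeight, vertexWeight]
    congr 1
    refine Set.Subset.antisymm (fun η hη i hi => ?_) (pathCylinder_anti _ (by omega))
    rcases Nat.lt_or_ge (2 * b) i with hi' | hi'
    swap
    · exact hη i hi'
    · obtain rfl : i = 2 * b + 1 := by omega
      obtain ⟨h1, h2⟩ := η.2.2 (2 * b)
      have h3 := hη (2 * b) le_rfl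
      rw [climbPath_apply] at h3 ⊢
      rw [if_neg (by omega)]
      rw [if_pos le_rfl] at h3
      simp only [add_zero] at *
      rw [h3] at h1 h2
      exact Prod.ext h1 (by dsimp only at h2 ⊢; omega)
  · have hdip : ((dipPath b k).1 (2 * b + (k + 2))).2 = k := by
      rw [dipPath_apply, if_neg (by omega)]
      dsimp only
      omega
    have e1 := h.measure_pathCylinder (dipPath b k) (2 * b + (k + 2)) (b + 1) (by rw [hdip]; ring)
    rw [hdip] at e1
    rw [← e1, vertexWeight, vertexWeight, ← measureReal_union]
    · congr 1
      refine Set.Subset.antisymm (fun η hη => ?_) (Set.union_subset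
        (pathCylinder_anti _ (by omega)) fun η hη i hi => ?_)
      · obtain ⟨h1, h2⟩ := η.2.2 (2 * b + (k + 1))
        have h3 := hη (2 * b + (k + 1)) le_rfl
        rw [climbPath_apply, if_neg (by omega)] at h3
        rw [h3] at h1 h2
        dsimp only at h1 h2
        rcases h2 with h2 | h2
        · left
          intro i hi
          rcases Nat.lt_or_ge (2 * b + (k + 1)) i with hi' | hi'
          · obtain rfl : i = 2 * b + (k + 1) + 1 := by omega
            rw [climbPath_apply, if_neg (by omega)]
            exact Prod.ext h1 (by dsimp only; omega)
          · exact hη i hi'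
        · right
          intro i hi
          rw [dipPath_apply]
          split_ifs with hi'
          · exact hη i hi'
          · obtain rfl : i = 2 * b + (k + 1) + 1 := by omega
            exact Prod.ext h1 (by dsimp only; omega)
      · rw [hη i (by omega), dipPath_apply, if_pos hi]
    · rw [Set.disjoint_left]
      intro η h1 h2
      have h3 := (h1 _ le_rfl).symm.trans (h2 _ le_rfl)
      have h4 := climbPath_height b (k + 2)
      rw [h3, hdip] at h4
      omega
    · exact measurableSet_pathCylinder _ _

theorem vertexWeight_zero (ν : Measure InfinitePath) [IsProbabilityMeasure ν] :
    vertexWeight ν 0 0 = 1 := by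
  rw [vertexWeight, show pathCylinder (climbPath 0) (2 * 0 + 0) = Set.univ from ?_]
  · simp
  · refine Set.eq_univ_of_forall fun η i hi => ?_
    obtain rfl : i = 0 := by omega
    rw [η.2.1, (climbPath 0).2.1]

end Ballot

/-! ### The mixture. -/

theorem mainTheorem5 (ν : MeasureTheory.Measure Ballot.InfinitePath)
    (hprob : MeasureTheory.IsProbabilityMeasure ν) (hcentral : Ballot.IsCentral ν) :
    ∃ μ : MeasureTheory.Measure (Set.Icc (1 / 2 : ℝ) 1),
      MeasureTheory.IsProbabilityMeasure μ ∧
      ∀ A : Set Ballot.InfinitePath, MeasurableSet A →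
        Measurable (fun lam : Set.Icc (1 / 2 : ℝ) 1 => Ballot.chainLaw lam A) ∧
        ν A = ∫⁻ lam, Ballot.chainLaw lam A ∂μ := by
  obtain ⟨μ, hμ, hw⟩ := hcentral.isHarmonic_vertexWeight.exists_eq_integral_pathWeight
    (fun _ _ => measureReal_nonneg) (Ballot.vertexWeight_zero ν)
  refine ⟨μ, hμ, fun A hA => ⟨(Measure.measurable_coe hA).comp Ballot.measurable_chainLaw, ?_⟩⟩
  suffices h : ν = μ.bind Ballot.chainLaw by
    rw [← Measure.bind_apply hA Ballot.measurable_chainLaw.aemeasurable, ← h]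
  have hbind : IsProbabilityMeasure (μ.bind Ballot.chainLaw) :=
    isProbabilityMeasure_bind Ballot.measurable_chainLaw.aemeasurable
      (.of_forall fun lam => Ballot.isProbabilityMeasure_chainLaw lam)
  refine ext_of_generate_finite _ Ballot.generateFrom_pathCylinders
    Ballot.isPiSystem_pathCylinders ?_ (by simp)
  rintro _ ⟨ω, n, rfl⟩
  obtain ⟨-, b, hb⟩ := Ballot.exists_downs ω n
  rw [Measure.bind_apply (Ballot.measurableSet_pathCylinder ω n)
    Ballot.measurable_chainLaw.aemeasurable]
  simp only [fun lam => Ballot.chainLaw_pathCylinder lam ω n b hb]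
  rw [← ofReal_integral_eq_lintegral_ofReal (Ballot.integrable_pathWeight μ _ _)
    (.of_forall fun lam => Ballot.pathWeight_nonneg lam.2 _ _), ← hw,
    ← hcentral.measure_pathCylinder ω n b hb, ofReal_measureReal]
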